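/- Let $n\ge 0$ be an integer and let $H\subset\mathbb{Z}^n\subset\mathbb{R}^n$ be a finite set. For $x\in\mathbb{R}^n$ write $\mathcal{A}_H(x)=(\operatorname{sign}\langle h,x\rangle : h\in H)\in\{-,0,+\}^H$, where $\langle\cdot,\cdot\rangle$ is the standard inner product. A \emph{comparison decision tree} for $H$ is a (finite, deterministic) ternary decision tree with input $x\in\mathbb{R}^n$, each of whose inner nodes queries $\operatorname{sign}\langle v,x\rangle\in\{-,0,+\}$ for a vector $v$ that either lies in $H$ (a label query) or has the form $v=h'-h''$ with $h',h''\in H$ (a comparison query), and branches according to the answer. It computes $\mathcal{A}_H$ if for every $x\in\mathbb{R}^n$ the leaf reached on input $x$ is labelled by $\mathcal{A}_H(x)$. Its query complexity is the maximum over $x\in\mathbb{R}^n$ of the number of queries made on input $x$. There is an absolute constant $C>0$ such that the following holds. Let $n$ be a nonnegative integer, $w$ a real number, and $H\subset\mathbb{Z}^n$ with $\|h\|_\infty=\max_i|h_i|\le w$ for all $h\in H$. If $nw\ge 2$ and $|H|\ge 2$, then there is a comparison decision tree for $H$ that computes $\mathcal{A}_H$ and has query complexity at most $$C\, n\,\log(nw)\,\log|H|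 .$$ -/

import Mathlib

/-- The sign vector `A_H(x) = (sign ⟨h, x⟩ : h ∈ H)` of the point-location problem for `H`. -/
noncomputable def signVector {n : ℕ} (H : Finset (Fin n → ℝ)) (x : Fin n → ℝ) :
    H → SignType :=
  fun h => SignType.sign ((h : Fin n → ℝ) ⬝ᵥ x)

/-- Ternary linear decision trees on `ℝⁿ` with outputs in `α`. An inner node carries the vector `v`
of the linear query `sign ⟨v, x⟩ = ?` and one subtree for each of the three possible answers. -/
inductive LinearDecisionTree (n : ℕ) (α : Type) : Type
  | leaf (output : α) : LinearDecisionTree n α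
  | node (v : Fin n → ℝ) (next : SignType → LinearDecisionTree n α) : LinearDecisionTree n α

namespace LinearDecisionTree

/-- The output of the tree on input `x`. -/
noncomputable def eval {n : ℕ} {α : Type} : LinearDecisionTree n α → (Fin n → ℝ) → α
  | leaf output, _ => output
  | node v next, x => (next (SignType.sign (v ⬝ᵥ x))).eval x

/-- The number of queries that the tree performs on input `x`. -/
noncomputable def numQueries {n : ℕ} {α : Type} : LinearDecisionTree n α → (Fin n → ℝ) → ℕ
  | leaf _, _ => 0
  | node v next, x => (next (SignType.sign (v ⬝ᵥ x))).numQueries x + 1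

/-- Every query of the tree is a label query (its vector lies in `H`) or a comparison query
(its vector is a difference of two elements of `H`). -/
def IsComparison {n : ℕ} {α : Type} (H : Finset (Fin n → ℝ)) : LinearDecisionTree n α → Prop
  | leaf _ => True
  | node v next =>
      (v ∈ H ∨ ∃ h' ∈ H, ∃ h'' ∈ H, v = h' - h'') ∧ ∀ s, (next s).IsComparison H

/-- The tree computes `f` correctly on every input. -/
def Computes {n : ℕ} {α : Type} (T : LinearDecisionTree n α) (f : (Fin n → ℝ) → α) : Prop :=
  ∀ x, T.eval x = f x

/-- The query complexity of `T` (the maximum over `x` of the number of queries) is at most `q`. -/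
def QueryComplexityLE {n : ℕ} {α : Type} (T : LinearDecisionTree n α) (q : ℝ) : Prop :=
  ∀ x, (T.numQueries x : ℝ) ≤ q

end LinearDecisionTree

/-! A form h is inferred from S at x when the labels of S and the comparisons within S at x force
the sign of h at x. At each round the tree takes a sequence W of 2M forms whose labels are still
open, with M of order n log(nw), sorts W together with 0, and discards every form whose label is
then inferred.

Inference is frequent. Sort m+1 integral forms of height at most w that are nonnegative at x. The
2^m subset sums of their successive differences lie in a box with fewer than 2^m lattice points once
m is a large multiple of n log(nw). A coincidence makes one form a conical combination of the
smallest form and earlier differences, so its label is inferred (`exists_eq_add_sum_smul_sub`,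
`infers_add_sum_smul_sub`). Hence in any sequence at most 2m entries are not inferred from the
others. Comparing two exponential moments of the number of inferred positions shows that a random W
infers at most 1/64 of the open forms with probability at most (2/3)^M (`card_few_inferred_le`). By
averaging, one fixed W fails on at most a (2/3)^M part of any finite set X of inputs.

A finite X suffices: labels and comparisons cut space into at most |H|^(5n) faces
(`exists_sign_representatives`). Binary search weighted by the surviving inputs sorts W with 4M + 2
log(|X|/|Y|) queries when Y survives (`Solvable.of_list`). After a round, either the open forms
shrink by a constant factor or X shrinks by (2/3)^M; a potential in log(1 + open forms) and log|X|
pays for both (`solvable_of_potential`). -/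

/-! ### Exponential moments of the number of inferred positions -/

open Classical in
/-- The number of positions of the sequence `W` (read from its end to its beginning) whose entry is
inferred from the entries read before it. -/
noncomputable def redundancy {α : Type*} (I : Set α → α → Prop) : (k : ℕ) → (Fin k → α) → ℕ
  | 0, _ => 0
  | k + 1, W => redundancy I k (Fin.tail W) + if I (Set.range (Fin.tail W)) (W 0) then 1 else 0

open Classical in
theorem sum_pow_ite_le {ι : Type*} [Fintype ι] (p : ι → Prop) (b : ℝ) :
    ∑ a, b ^ (if p a then 1 else 0) =
      (Finset.univ.filter fun a => ¬ p a).card + b * (Finset.univ.filter p).card := by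
  have h : ∀ a, b ^ (if p a then 1 else 0) = (if ¬ p a then 1 else 0) + b * (if p a then 1 else 0) := by
    intro a; by_cases h : p a <;> simp [h]
  simp only [h, Finset.sum_add_distrib, ← Finset.mul_sum, Finset.sum_boole]

-- The sequence is built from its end. By monotonicity each tail also infers at most a δ part of the
-- ground set, so a new entry has at most δ|α| inferred choices, each of weight b, and the others
-- have weight 1.
open Classical in
theorem sum_pow_redundancy_le {α : Type*} [Fintype α] {I : Set α → α → Prop}
    (hI : ∀ S T a, S ⊆ T → I S a → I T a) {δ b : ℝ} (hδ : 0 ≤ δ) (hb : 0 ≤ b) (k : ℕ) :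
    ∑ W : Fin k → α with
        ((Finset.univ.filter fun a => I (Set.range W) a).card : ℝ) ≤ δ * Fintype.card α,
      b ^ redundancy I k W ≤ ((1 + δ * b) * Fintype.card α) ^ k := by
  induction k with
  | zero =>
    simp only [redundancy, pow_zero]
    rw [Finset.sum_const, nsmul_eq_mul, mul_one]
    calc _ ≤ ((Finset.univ : Finset (Fin 0 → α)).card : ℝ) := by
          exact_mod_cast Finset.card_filter_le _ _
      _ = 1 := by simp
  | succ k ih =>
    rw [Finset.sum_filter, ← (Fin.consEquiv fun _ : Fin (k + 1) => α).sum_comp,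
      Fintype.sum_prod_type, Finset.sum_comm]
    rw [Finset.sum_filter] at ih
    calc _ ≤ ∑ W : Fin k → α, ((1 + δ * b) * Fintype.card α) *
            (if ((Finset.univ.filter fun a => I (Set.range W) a).card : ℝ) ≤ δ * Fintype.card α
              then b ^ redundancy I k W else 0) := by
          refine Finset.sum_le_sum fun W _ => ?_
          split_ifs with hW
          · calc _ ≤ ∑ a, b ^ redundancy I k W * b ^ (if I (Set.range W) a then 1 else 0) := by
                  refine Finset.sum_le_sum fun a _ => ?_
                  split_ifs <;> simp_all [Fin.consEquiv, redundancy, pow_succ]; positivity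
              _ ≤ _ := by
                  rw [← Finset.mul_sum, sum_pow_ite_le, mul_comm]
                  refine mul_le_mul_of_nonneg_right ?_ (by positivity)
                  have h1 : ((Finset.univ.filter fun a => ¬ I (Set.range W) a).card : ℝ)
                      ≤ Fintype.card α := by exact_mod_cast Finset.card_le_univ _
                  nlinarith
          · rw [mul_zero]
            refine (Finset.sum_eq_zero fun a _ => if_neg fun h => hW (le_trans ?_ h)).le
            refine Nat.cast_le.2 (Finset.card_le_card fun c hc => ?_)
            simp only [Finset.mem_filter, Finset.mem_univ, true_and] at hc ⊢
            refine hI _ _ _ ?_ hc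
            rintro _ ⟨i, rfl⟩
            exact ⟨i.succ, by simp [Fin.consEquiv]⟩
      _ ≤ _ := by
          rw [← Finset.mul_sum, pow_succ']
          exact mul_le_mul_of_nonneg_left ih (by positivity)

-- In a random order, the entry read last is a uniformly random index p, and all other entries are
-- read before it. It fails to be inferred for at most d of the k + 1 choices of p; the rest of the
-- order is again random.
open Classical in
theorem sum_perm_pow_redundancy_le {α : Type*} {I : Set α → α → Prop} {d : ℕ}
    (hd : ∀ (k : ℕ) (W : Fin k → α),
      (Finset.univ.filter fun i => ¬ I (W '' {j | j ≠ i}) (W i)).card ≤ d)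
    {c : ℝ} (hc : 0 ≤ c) (k : ℕ) (W : Fin k → α) :
    ∑ σ : Equiv.Perm (Fin k), c ^ redundancy I k (W ∘ σ) ≤
      k.factorial * ∏ t ∈ Finset.range k, (min 1 (d / (t + 1 : ℝ)) + c) := by
  induction k with
  | zero => simp [redundancy]
  | succ k ih =>
    rw [← Equiv.Perm.decomposeFin.symm.sum_comp, Fintype.sum_prod_type]
    set P := ∏ t ∈ Finset.range k, (min 1 (d / (t + 1 : ℝ)) + c) with hP
    have hP0 : 0 ≤ P := Finset.prod_nonneg fun t _ => by positivity
    have hrange : ∀ p : Fin (k + 1),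
        Set.range (fun i : Fin k => W (Equiv.swap 0 p i.succ)) = W '' {j | j ≠ p} := by
      intro p
      ext a
      simp only [Set.mem_range, Set.mem_image, Set.mem_ofPred_eq]
      constructor
      · rintro ⟨i, rfl⟩
        refine ⟨_, fun h => ?_, rfl⟩
        have := congrArg (Equiv.swap 0 p) h
        simp at this
      · rintro ⟨j, hj, rfl⟩
        have h0 : Equiv.swap 0 p j ≠ 0 := fun h => hj (by
          have := congrArg (Equiv.swap 0 p) h
          simpa using this)
        obtain ⟨i, hi⟩ := Fin.exists_succ_eq.2 h0
        exact ⟨i, by rw [hi]; simp⟩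
    calc _ = ∑ p : Fin (k + 1), c ^ (if I (W '' {j | j ≠ p}) (W p) then 1 else 0) *
            ∑ e : Equiv.Perm (Fin k),
              c ^ redundancy I k ((fun i : Fin k => W (Equiv.swap 0 p i.succ)) ∘ e) := by
          refine Finset.sum_congr rfl fun p _ => ?_
          rw [Finset.mul_sum]
          refine Finset.sum_congr rfl fun e _ => ?_
          have ht : Fin.tail (W ∘ Equiv.Perm.decomposeFin.symm (p, e)) =
              (fun i : Fin k => W (Equiv.swap 0 p i.succ)) ∘ e := by
            ext i; simp [Fin.tail]
          have hr : Set.range ((fun i : Fin k => W (Equiv.swap 0 p i.succ)) ∘ e) =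
              W '' {j | j ≠ p} := by
            rw [e.surjective.range_comp, hrange]
          rw [redundancy, ht, hr, pow_add, mul_comm]
          simp
      _ ≤ ∑ p : Fin (k + 1), c ^ (if I (W '' {j | j ≠ p}) (W p) then 1 else 0) *
            (k.factorial * P) :=
          Finset.sum_le_sum fun p _ => mul_le_mul_of_nonneg_left (ih _) (by positivity)
      _ ≤ ((k + 1 : ℝ) * (min 1 (d / (k + 1 : ℝ)) + c)) * (k.factorial * P) := by
          rw [← Finset.sum_mul, sum_pow_ite_le]
          refine mul_le_mul_of_nonneg_right ?_ (by positivity)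
          have h1 : ((Finset.univ.filter fun p => ¬ I (W '' {j | j ≠ p}) (W p)).card : ℝ) ≤ d := by
            exact_mod_cast hd _ W
          have h2 : ((Finset.univ.filter fun p => ¬ I (W '' {j | j ≠ p}) (W p)).card : ℝ)
              ≤ k + 1 := by
            exact_mod_cast (Finset.card_le_univ _).trans (by simp)
          have h3 : ((Finset.univ.filter fun p => I (W '' {j | j ≠ p}) (W p)).card : ℝ)
              ≤ k + 1 := by
            exact_mod_cast (Finset.card_le_univ _).trans (by simp)
          have h4 : (k + 1 : ℝ) * min 1 (d / (k + 1 : ℝ)) = min (k + 1 : ℝ) d := by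
            rw [mul_min_of_nonneg _ _ (by positivity), mul_one, mul_div_cancel₀]
            positivity
          rw [mul_add, h4, mul_comm c]
          exact add_le_add (le_min h2 h1) (mul_le_mul_of_nonneg_right h3 hc)
      _ = _ := by
          rw [Finset.prod_range_succ, ← hP, Nat.factorial_succ]
          push_cast
          ring

-- Symmetrization: permuting positions preserves the sum over all sequences, so it can be averaged
-- over permutations.
open Classical in
theorem sum_inv_pow_redundancy_le {α : Type*} [Fintype α] {I : Set α → α → Prop} {d : ℕ}
    (hd : ∀ (k : ℕ) (W : Fin k → α),
      (Finset.univ.filter fun i => ¬ I (W '' {j | j ≠ i}) (W i)).card ≤ d)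
    {c : ℝ} (hc : 0 ≤ c) (k : ℕ) :
    ∑ W : Fin k → α, c ^ redundancy I k W ≤
      (Fintype.card α : ℝ) ^ k * ∏ t ∈ Finset.range k, (min 1 (d / (t + 1 : ℝ)) + c) := by
  have h1 : ∀ σ : Equiv.Perm (Fin k), ∑ W : Fin k → α, c ^ redundancy I k (W ∘ σ) =
      ∑ W : Fin k → α, c ^ redundancy I k W := fun σ =>
    (Equiv.arrowCongr σ.symm (Equiv.refl α)).sum_comp fun W => c ^ redundancy I k W
  have h2 := Finset.sum_le_sum fun (W : Fin k → α) (_ : W ∈ Finset.univ) =>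
    sum_perm_pow_redundancy_le hd hc k W
  rw [Finset.sum_comm, Finset.sum_congr rfl fun σ _ => h1 σ] at h2
  simp only [Finset.sum_const, Finset.card_univ, Fintype.card_perm, Fintype.card_fin, nsmul_eq_mul,
    Fintype.card_fun, Nat.cast_pow] at h2
  have hf : (0 : ℝ) < k.factorial := by exact_mod_cast k.factorial_pos
  refine le_of_mul_le_mul_left ?_ hf
  linarith

open Classical in
/-- If no sequence has more than `d` entries that are not inferred from its other entries, then all
but an exponentially small part of the sequences of length `2 * M ≥ 16 * d` infer more than a
sixty-fourth of the ground set. -/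
theorem card_few_inferred_le {α : Type*} [Fintype α] {I : Set α → α → Prop}
    (hI : ∀ S T a, S ⊆ T → I S a → I T a) {d M : ℕ} (hM : 8 * d ≤ M)
    (hd : ∀ (k : ℕ) (W : Fin k → α),
      (Finset.univ.filter fun i => ¬ I (W '' {j | j ≠ i}) (W i)).card ≤ d) :
    ((Finset.univ.filter fun W : Fin (2 * M) → α =>
      ((Finset.univ.filter fun a => I (Set.range W) a).card : ℝ) ≤ 1 / 64 * Fintype.card α).card : ℝ)
      ≤ (2 / 3) ^ M * (Fintype.card α : ℝ) ^ (2 * M) := by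
  set B := Finset.univ.filter fun W : Fin (2 * M) → α =>
      ((Finset.univ.filter fun a => I (Set.range W) a).card : ℝ) ≤ 1 / 64 * Fintype.card α with hB
  have h1 : ∑ W ∈ B, (8 : ℝ) ^ redundancy I (2 * M) W ≤
      (81 / 64) ^ M * (Fintype.card α : ℝ) ^ (2 * M) := by
    refine (sum_pow_redundancy_le hI (by norm_num) (by norm_num) (2 * M)).trans (le_of_eq ?_)
    rw [mul_pow, pow_mul (1 + 1 / 64 * 8 : ℝ)]
    norm_num
  -- The first M factors are bounded by 1 + 1/8, the last M by 1/8 + 1/8 because 8d ≤ M.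
  have hprod : ∏ t ∈ Finset.range (2 * M), (min 1 (d / (t + 1 : ℝ)) + 1 / 8) ≤ (9 / 32 : ℝ) ^ M := by
    rw [two_mul, Finset.prod_range_add]
    calc _ ≤ (∏ t ∈ Finset.range M, (9 / 8 : ℝ)) * ∏ t ∈ Finset.range M, (1 / 4 : ℝ) := by
          refine mul_le_mul ?_ ?_ (Finset.prod_nonneg fun t _ => by positivity)
            (Finset.prod_nonneg fun t _ => by positivity)
          · refine Finset.prod_le_prod (fun t _ => by positivity) fun t _ => ?_
            have := min_le_left 1 (d / (t + 1 : ℝ))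
            linarith
          · refine Finset.prod_le_prod (fun t _ => by positivity) fun t _ => ?_
            have h3 : (d / (((M + t : ℕ) : ℝ) + 1) : ℝ) ≤ 1 / 8 := by
              rw [div_le_iff₀ (by positivity)]
              have : (8 * d : ℝ) ≤ M := by exact_mod_cast hM
              push_cast
              have : (0 : ℝ) ≤ t := by positivity
              linarith
            have := min_le_right 1 (d / (((M + t : ℕ) : ℝ) + 1) : ℝ)
            linarith
      _ = _ := by
          rw [Finset.prod_const, Finset.prod_const, Finset.card_range, ← mul_pow]
          norm_num
  have h2 : ∑ W ∈ B, (1 / 8 : ℝ) ^ redundancy I (2 * M) W ≤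
      (9 / 32) ^ M * (Fintype.card α : ℝ) ^ (2 * M) := by
    calc _ ≤ ∑ W : Fin (2 * M) → α, (1 / 8 : ℝ) ^ redundancy I (2 * M) W :=
          Finset.sum_le_sum_of_subset_of_nonneg (Finset.filter_subset _ _)
            fun _ _ _ => by positivity
      _ ≤ _ := sum_inv_pow_redundancy_le hd (by norm_num) _
      _ ≤ _ := by
          rw [mul_comm]
          exact mul_le_mul_of_nonneg_right hprod (by positivity)
  -- AM-GM: the two weights are reciprocal, so they sum to at least 2. They balance at redundancy
  -- M/3: few inferred choices make larger values rare, and the bound d makes smaller values rare.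
  have h3 : (2 * B.card : ℝ) ≤ (1 / 2) ^ M * ∑ W ∈ B, (8 : ℝ) ^ redundancy I (2 * M) W +
      2 ^ M * ∑ W ∈ B, (1 / 8 : ℝ) ^ redundancy I (2 * M) W := by
    rw [Finset.mul_sum, Finset.mul_sum, ← Finset.sum_add_distrib, mul_comm, ← nsmul_eq_mul,
      ← Finset.sum_const]
    refine Finset.sum_le_sum fun W _ => ?_
    set u : ℝ := (1 / 2) ^ M * 8 ^ redundancy I (2 * M) W
    set v : ℝ := 2 ^ M * (1 / 8) ^ redundancy I (2 * M) W
    have huv : u * v = 1 := by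
      have : u * v = (1 / 2 * 2) ^ M * (8 * (1 / 8)) ^ redundancy I (2 * M) W := by
        simp only [u, v, mul_pow]; ring
      rw [this]; norm_num
    have hu : 0 < u := by positivity
    have hv : 0 < v := by positivity
    nlinarith [sq_nonneg (u - v)]
  have h4 : ((1 / 2) ^ M * (81 / 64) ^ M : ℝ) ≤ (2 / 3) ^ M := by
    rw [← mul_pow]; exact pow_le_pow_left₀ (by norm_num) (by norm_num) M
  have h5 : (2 ^ M * (9 / 32) ^ M : ℝ) ≤ (2 / 3) ^ M := by
    rw [← mul_pow]; exact pow_le_pow_left₀ (by norm_num) (by norm_num) M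
  have hK : (0 : ℝ) ≤ (Fintype.card α : ℝ) ^ (2 * M) := by positivity
  have h6 := mul_le_mul_of_nonneg_left h1 (show (0 : ℝ) ≤ (1 / 2) ^ M by positivity)
  have h7 := mul_le_mul_of_nonneg_left h2 (show (0 : ℝ) ≤ 2 ^ M by positivity)
  have h8 := mul_le_mul_of_nonneg_right h4 hK
  have h9 := mul_le_mul_of_nonneg_right h5 hK
  linarith

/-! ### Averaging: one choice that is good for most inputs -/

open Classical in
theorem exists_card_filter_le_of_forall_card_le {ι β : Type*} [Fintype ι] [Nonempty ι]
    (X : Finset β) (bad : ι → β → Prop) {ρ : ℝ}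
    (h : ∀ x ∈ X, ((Finset.univ.filter fun i => bad i x).card : ℝ) ≤ ρ * Fintype.card ι) :
    ∃ i, ((X.filter (bad i)).card : ℝ) ≤ ρ * X.card := by
  have h1 : ∑ i, ((X.filter (bad i)).card : ℝ) ≤ ∑ _i : ι, ρ * X.card := by
    have h2 : ∑ i, (X.filter (bad i)).card = ∑ x ∈ X, (Finset.univ.filter fun i => bad i x).card :=
      Finset.sum_card_bipartiteAbove_eq_sum_card_bipartiteBelow _
    calc _ = ∑ x ∈ X, ((Finset.univ.filter fun i => bad i x).card : ℝ) := by exact_mod_cast h2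
      _ ≤ ∑ x ∈ X, ρ * Fintype.card ι := Finset.sum_le_sum h
      _ = _ := by
          simp only [Finset.sum_const, nsmul_eq_mul, Finset.card_univ]
          ring
  obtain ⟨i, -, hi⟩ := Finset.exists_le_of_sum_le Finset.univ_nonempty h1
  exact ⟨i, hi⟩

/-! ### Inference from labels and comparisons -/

/-- The linear forms in `T` are ordered in the same way by their values at `x` and at `y`. -/
def SameOrder {n : ℕ} (T : Set (Fin n → ℝ)) (x y : Fin n → ℝ) : Prop :=
  ∀ s ∈ T, ∀ t ∈ T, s ⬝ᵥ x < t ⬝ᵥ x ↔ s ⬝ᵥ y < t ⬝ᵥ y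

/-- The label of `h` at `x` follows from the labels of and the comparisons within `S` at `x`. -/
def Infers {n : ℕ} (x : Fin n → ℝ) (S : Set (Fin n → ℝ)) (h : Fin n → ℝ) : Prop :=
  ∀ y, SameOrder (insert 0 S) x y → SignType.sign (h ⬝ᵥ y) = SignType.sign (h ⬝ᵥ x)

theorem SameOrder.mono {n : ℕ} {S T : Set (Fin n → ℝ)} {x y : Fin n → ℝ} (hST : S ⊆ T)
    (h : SameOrder T x y) : SameOrder S x y :=
  fun s hs t ht => h s (hST hs) t (hST ht)

theorem SameOrder.le_iff {n : ℕ} {T : Set (Fin n → ℝ)} {x y : Fin n → ℝ} (h : SameOrder T x y)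
    {s t : Fin n → ℝ} (hs : s ∈ T) (ht : t ∈ T) : s ⬝ᵥ x ≤ t ⬝ᵥ x ↔ s ⬝ᵥ y ≤ t ⬝ᵥ y := by
  rw [← not_lt, ← not_lt, h t ht s hs]

theorem sign_eq_of_pos_iff {a b : ℝ} (h1 : 0 < a ↔ 0 < b) (h2 : a < 0 ↔ b < 0) :
    SignType.sign a = SignType.sign b := by
  rw [sign_apply, sign_apply, if_congr h1 rfl (if_congr h2 rfl rfl)]

theorem Infers.mono {n : ℕ} {x : Fin n → ℝ} {S T : Set (Fin n → ℝ)} {h : Fin n → ℝ} (hST : S ⊆ T)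
    (hS : Infers x S h) : Infers x T h :=
  fun y hy => hS y (hy.mono (Set.insert_subset_insert hST))

theorem infers_of_mem {n : ℕ} {x : Fin n → ℝ} {S : Set (Fin n → ℝ)} {h : Fin n → ℝ} (hS : h ∈ S) :
    Infers x S h := by
  intro y hy
  have h0 : (0 : Fin n → ℝ) ∈ insert 0 S := Set.mem_insert _ _
  have h1 : h ∈ insert 0 S := Set.mem_insert_of_mem _ hS
  refine sign_eq_of_pos_iff ?_ ?_
  · simpa using (hy 0 h0 h h1).symm
  · simpa using (hy h h1 0 h0).symm

theorem Infers.neg {n : ℕ} {x : Fin n → ℝ} {S : Set (Fin n → ℝ)} {h : Fin n → ℝ}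
    (hS : Infers (-x) S h) : Infers x S h := by
  intro y hy
  have := hS (-y) fun s hs t ht => by simpa using hy t ht s hs
  simpa [Left.sign_neg] using this

/-! ### Inference dimension of integral vectors of bounded height -/

/-- Among many integral vectors of bounded height, listed in any order, one is a conical combination
of the first one and of the successive differences before it. -/
theorem exists_eq_add_sum_smul_sub {n m : ℕ} {w : ℝ} (hw : 0 ≤ w) (h : ℕ → Fin n → ℝ)
    (hint : ∀ j ≤ m, ∀ i, ∃ k : ℤ, h j i = k) (hbd : ∀ j ≤ m, ‖h j‖ ≤ w)
    (hm : (4 * w * m + 1) ^ n < 2 ^ m) :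
    ∃ p < m, ∃ c : ℕ → ℝ, (∀ j, 0 ≤ c j) ∧
      h (p + 1) = h 0 + ∑ j ∈ Finset.range p, c j • (h (j + 1) - h j) := by
  choose! z hz using hint
  have hzb : ∀ j ≤ m, ∀ i, |(z j i : ℝ)| ≤ w := fun j hj i => by
    rw [← hz j hj i]
    exact (norm_le_pi_norm (h j) i).trans (hbd j hj)
  let F : Finset ℕ → Fin n → ℤ := fun A i => ∑ j ∈ A, (z (j + 1) i - z j i)
  let K : ℕ := ⌊2 * w * m⌋₊
  have hmaps : ∀ A ∈ (Finset.range m).powerset,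
      F A ∈ Fintype.piFinset fun _ : Fin n => Finset.Icc (-(K : ℤ)) K := by
    intro A hA
    rw [Fintype.mem_piFinset]
    intro i
    rw [Finset.mem_Icc, ← abs_le]
    have h1 : |((F A i : ℤ) : ℝ)| ≤ 2 * w * m := by
      simp only [F]
      push_cast
      calc _ ≤ ∑ j ∈ A, |(z (j + 1) i : ℝ) - z j i| := Finset.abs_sum_le_sum_abs _ _
        _ ≤ ∑ j ∈ A, 2 * w := by
            refine Finset.sum_le_sum fun j hj => ?_
            have hj' := Finset.mem_range.1 (Finset.mem_powerset.1 hA hj)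
            have := abs_sub (z (j + 1) i : ℝ) (z j i)
            linarith [hzb (j + 1) hj' i, hzb j hj'.le i]
        _ = A.card * (2 * w) := by simp
        _ ≤ m * (2 * w) := by
            refine mul_le_mul_of_nonneg_right ?_ (by positivity)
            exact_mod_cast (Finset.card_le_card (Finset.mem_powerset.1 hA)).trans (by simp)
        _ = _ := by ring
    have h2 : ((F A i).natAbs : ℝ) ≤ 2 * w * m := by
      rwa [Nat.cast_natAbs, Int.cast_abs]
    have h3 := Nat.le_floor h2
    rw [Int.abs_eq_natAbs]
    exact_mod_cast h3
  have hcard : (Fintype.piFinset fun _ : Fin n => Finset.Icc (-(K : ℤ)) K).card <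
      (Finset.range m).powerset.card := by
    rw [Fintype.card_piFinset, Finset.prod_const, Int.card_Icc, Finset.card_powerset,
      Finset.card_range, Finset.card_univ, Fintype.card_fin]
    have h1 : ((K : ℤ) + 1 - -(K : ℤ)).toNat = 2 * K + 1 := by omega
    rw [h1]
    have h2 : (K : ℝ) ≤ 2 * w * m := Nat.floor_le (by positivity)
    have h3 : ((2 * K + 1 : ℕ) : ℝ) ^ n ≤ (4 * w * m + 1) ^ n := by
      refine pow_le_pow_left₀ (by positivity) ?_ n
      push_cast
      linarith
    exact_mod_cast h3.trans_lt hm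
  obtain ⟨A, hA, B, hB, hne, hAB⟩ :=
    Finset.exists_ne_map_eq_of_card_lt_of_maps_to hcard hmaps
  -- Here p is the largest index at which A and B differ. Cancelling beyond p expresses the p-th
  -- difference through earlier ones.
  have key : ∀ A B : Finset ℕ, A ⊆ Finset.range m → B ⊆ Finset.range m → F A = F B →
      ∀ p ∈ B, p ∉ A → (∀ q, p < q → (q ∈ A ↔ q ∈ B)) →
      ∃ p < m, ∃ c : ℕ → ℝ, (∀ j, 0 ≤ c j) ∧
        h (p + 1) = h 0 + ∑ j ∈ Finset.range p, c j • (h (j + 1) - h j) := by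
    intro A B hA hB hAB p hpB hpA hq
    have hpm : p < m := Finset.mem_range.1 (hB hpB)
    -- The 1 telescopes from h 0 to h p, and the indicators of A minus B contribute the p-th
    -- difference. The coefficients lie in {0, 1, 2}.
    refine ⟨p, hpm, fun j => 1 + (if j ∈ A then 1 else 0) - (if j ∈ B then 1 else 0),
      fun j => by dsimp only; split_ifs <;> norm_num, ?_⟩
    have hsum : ∀ C ⊆ Finset.range m, ∀ i, ((F C i : ℤ) : ℝ) =
        ∑ j ∈ Finset.range m, (if j ∈ C then 1 else 0) * (h (j + 1) i - h j i) := by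
      intro C hC i
      simp only [ite_mul, one_mul, zero_mul, F]
      rw [← Finset.sum_filter, Finset.filter_mem_eq_inter, Finset.inter_eq_right.2 hC]
      push_cast
      refine Finset.sum_congr rfl fun j hj => ?_
      have hj' := Finset.mem_range.1 (hC hj)
      rw [hz _ hj', hz _ hj'.le]
    ext i
    have h1 : ∑ j ∈ Finset.range m, ((if j ∈ A then 1 else 0) - (if j ∈ B then 1 else 0)) *
        (h (j + 1) i - h j i) = 0 := by
      simp only [sub_mul, Finset.sum_sub_distrib] at *
      rw [← hsum A hA i, ← hsum B hB i, hAB, sub_self]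
    have h2 : ∑ j ∈ Finset.range (p + 1), ((if j ∈ A then 1 else 0) - (if j ∈ B then 1 else 0)) *
        (h (j + 1) i - h j i) = 0 := by
      refine (Finset.sum_subset (Finset.range_subset_range.2 hpm) fun j _ hj => ?_).trans h1
      rw [Finset.mem_range, not_lt] at hj
      rw [if_congr (hq j hj) rfl rfl, sub_self, zero_mul]
    rw [Finset.sum_range_succ, if_neg hpA, if_pos hpB] at h2
    have h3 := Finset.sum_range_sub (fun j => h j i) p
    simp only [Pi.add_apply, Finset.sum_apply, Pi.smul_apply, Pi.sub_apply, smul_eq_mul, add_sub_assoc,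
      add_mul (1 : ℝ), one_mul, Finset.sum_add_distrib, h3]
    linarith
  have hD : (symmDiff A B).Nonempty := by
    rw [Finset.nonempty_iff_ne_empty, ne_eq, ← Finset.bot_eq_empty, symmDiff_eq_bot]
    exact hne
  have hmax := (symmDiff A B).max'_mem hD
  have hq : ∀ q, (symmDiff A B).max' hD < q → (q ∈ A ↔ q ∈ B) := by
    intro q hlt
    by_contra hcon
    refine absurd ((symmDiff A B).le_max' q ?_) (not_le.2 hlt)
    rw [Finset.mem_symmDiff]
    tauto
  rw [Finset.mem_powerset] at hA hB
  rcases Finset.mem_symmDiff.1 hmax with ⟨h1, h2⟩ | ⟨h1, h2⟩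
  · exact key B A hB hA hAB.symm _ h1 h2 fun q hlt => (hq q hlt).symm
  · exact key A B hA hB hAB _ h1 h2 hq

theorem exists_monotone_enumeration {ι : Type*} (s : Finset ι) (f : ι → ℝ) {m : ℕ}
    (hs : m < s.card) : ∃ g : ℕ → ι, (∀ j ≤ m, g j ∈ s) ∧
      (∀ i ≤ m, ∀ j ≤ m, g i = g j → i = j) ∧ ∀ i ≤ m, ∀ j ≤ m, i ≤ j → f (g i) ≤ f (g j) := by
  have : NeZero s.card := ⟨by omega⟩
  let F : Fin s.card → ℝ := fun i => f (s.equivFin.symm i)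
  refine ⟨fun j => s.equivFin.symm (Tuple.sort F (Fin.ofNat s.card j)), fun j _ => Subtype.coe_prop _,
    fun i hi j hj hij => ?_, fun i hi j hj hij => ?_⟩
  · have h1 := (Tuple.sort F).injective (s.equivFin.symm.injective (Subtype.ext hij))
    have h2 := congrArg Fin.val h1
    simpa [Nat.mod_eq_of_lt (hi.trans_lt hs), Nat.mod_eq_of_lt (hj.trans_lt hs)] using h2
  · refine Tuple.monotone_sort F (Fin.le_def.2 ?_)
    simpa [Nat.mod_eq_of_lt (hi.trans_lt hs), Nat.mod_eq_of_lt (hj.trans_lt hs)] using hij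

theorem pos_sum_iff_of_nonneg {ι : Type*} {s : Finset ι} {f g : ι → ℝ} (hf : ∀ i ∈ s, 0 ≤ f i)
    (hg : ∀ i ∈ s, 0 ≤ g i) (hfg : ∀ i ∈ s, 0 < f i ↔ 0 < g i) :
    0 < ∑ i ∈ s, f i ↔ 0 < ∑ i ∈ s, g i := by
  rw [Finset.sum_pos_iff_of_nonneg hf, Finset.sum_pos_iff_of_nonneg hg]
  exact exists_congr fun i => and_congr_right fun hi => hfg i hi

/-- If the values at `x` of `h 0, …, h p` are nonnegative and nondecreasing, then the labels of and
comparisons between these forms determine the label of each conical combination of `h 0` and the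
successive differences. -/
theorem infers_add_sum_smul_sub {n p : ℕ} {x : Fin n → ℝ} (h : ℕ → Fin n → ℝ) {c : ℕ → ℝ}
    (hc : ∀ j, 0 ≤ c j) (h0 : 0 ≤ h 0 ⬝ᵥ x) (hmono : ∀ j < p, h j ⬝ᵥ x ≤ h (j + 1) ⬝ᵥ x) :
    Infers x (h '' Set.Iic p) (h 0 + ∑ j ∈ Finset.range p, c j • (h (j + 1) - h j)) := by
  intro y hy
  have hmem : ∀ j ≤ p, h j ∈ insert 0 (h '' Set.Iic p) := fun j hj =>
    Set.mem_insert_of_mem _ ⟨j, hj, rfl⟩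
  have hz : (0 : Fin n → ℝ) ∈ insert 0 (h '' Set.Iic p) := Set.mem_insert _ _
  have h0y : 0 ≤ h 0 ⬝ᵥ y := by simpa using (hy.le_iff hz (hmem 0 (by simp))).1 (by simpa using h0)
  have hmonoy : ∀ j < p, h j ⬝ᵥ y ≤ h (j + 1) ⬝ᵥ y := fun j hj =>
    (hy.le_iff (hmem j hj.le) (hmem _ hj)).1 (hmono j hj)
  have h0lt : 0 < h 0 ⬝ᵥ y ↔ 0 < h 0 ⬝ᵥ x := by simpa using (hy 0 hz _ (hmem 0 (by simp))).symm
  have key : ∀ v : Fin n → ℝ, (h 0 + ∑ j ∈ Finset.range p, c j • (h (j + 1) - h j)) ⬝ᵥ v =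
      h 0 ⬝ᵥ v + ∑ j ∈ Finset.range p, c j * (h (j + 1) ⬝ᵥ v - h j ⬝ᵥ v) := by
    intro v
    simp [add_dotProduct, sum_dotProduct, smul_dotProduct, sub_dotProduct]
  have hnx : ∀ j ∈ Finset.range p, 0 ≤ c j * (h (j + 1) ⬝ᵥ x - h j ⬝ᵥ x) := fun j hj =>
    mul_nonneg (hc j) (sub_nonneg.2 (hmono j (Finset.mem_range.1 hj)))
  have hny : ∀ j ∈ Finset.range p, 0 ≤ c j * (h (j + 1) ⬝ᵥ y - h j ⬝ᵥ y) := fun j hj =>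
    mul_nonneg (hc j) (sub_nonneg.2 (hmonoy j (Finset.mem_range.1 hj)))
  -- A sum of nonnegative terms is positive exactly when some term is, so only the strictness of
  -- each comparison matters.
  have hiff : 0 < ∑ j ∈ Finset.range p, c j * (h (j + 1) ⬝ᵥ y - h j ⬝ᵥ y) ↔
      0 < ∑ j ∈ Finset.range p, c j * (h (j + 1) ⬝ᵥ x - h j ⬝ᵥ x) := by
    refine pos_sum_iff_of_nonneg hny hnx fun j hj => ?_
    rcases (hc j).eq_or_lt with hcj | hcj
    · simp [← hcj]
    · rw [mul_pos_iff_of_pos_left hcj, mul_pos_iff_of_pos_left hcj, sub_pos, sub_pos]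
      have hj' := Finset.mem_range.1 hj
      exact (hy _ (hmem j hj'.le) _ (hmem _ hj')).symm
  have hX := Finset.sum_nonneg hnx
  have hY := Finset.sum_nonneg hny
  rw [key, key]
  refine sign_eq_of_pos_iff ?_ ?_
  · constructor <;> intro hlt
    · by_contra hcon
      have h1 : ¬ 0 < h 0 ⬝ᵥ x := fun h' => hcon (by linarith)
      have h2 := mt hiff.1 fun h' => hcon (by linarith)
      have h3 := mt h0lt.1 h1
      linarith
    · by_contra hcon
      have h1 : ¬ 0 < h 0 ⬝ᵥ y := fun h' => hcon (by linarith)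
      have h2 := mt hiff.2 fun h' => hcon (by linarith)
      have h3 := mt h0lt.2 h1
      linarith
  · constructor <;> intro hlt <;> linarith

-- More than m such indices, sorted by value at x, would include one whose form is inferred from the
-- preceding ones. Indices are counted, so repeated vectors are allowed.
open Classical in
theorem card_nonneg_not_infers_le {n m k : ℕ} {w : ℝ} (hw : 0 ≤ w)
    (hm : (4 * w * m + 1) ^ n < 2 ^ m) (x : Fin n → ℝ) (W : Fin k → Fin n → ℝ)
    (hint : ∀ j i, ∃ z : ℤ, W j i = z) (hbd : ∀ j, ‖W j‖ ≤ w) :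
    (Finset.univ.filter fun i => 0 ≤ W i ⬝ᵥ x ∧ ¬ Infers x (W '' {j | j ≠ i}) (W i)).card ≤ m := by
  by_contra hcon
  obtain ⟨g, hg, hinj, hmono⟩ :=
    exists_monotone_enumeration _ (fun i => W i ⬝ᵥ x) (not_le.1 hcon)
  simp only [Finset.mem_filter, Finset.mem_univ, true_and] at hg
  obtain ⟨p, hp, c, hc, heq⟩ := exists_eq_add_sum_smul_sub hw (fun j => W (g j))
    (fun j _ => hint _) (fun j _ => hbd _) hm
  refine (hg (p + 1) hp).2 ?_
  rw [heq]
  refine (infers_add_sum_smul_sub (fun j => W (g j)) hc (hg 0 (by simp)).1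
    fun j hj => hmono j (by omega) (j + 1) (by omega) (by omega)).mono ?_
  rintro _ ⟨j, hj, rfl⟩
  rw [Set.mem_Iic] at hj
  exact ⟨g j, fun h => by have := hinj j (by omega) (p + 1) hp h; omega, rfl⟩

open Classical in
/-- The inference dimension of integral vectors of bounded height. -/
theorem card_not_infers_le {n m k : ℕ} {w : ℝ} (hw : 0 ≤ w)
    (hm : (4 * w * m + 1) ^ n < 2 ^ m) (x : Fin n → ℝ) (W : Fin k → Fin n → ℝ)
    (hint : ∀ j i, ∃ z : ℤ, W j i = z) (hbd : ∀ j, ‖W j‖ ≤ w) :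
    (Finset.univ.filter fun i => ¬ Infers x (W '' {j | j ≠ i}) (W i)).card ≤ 2 * m := by
  have h1 := card_nonneg_not_infers_le hw hm x W hint hbd
  have h2 := card_nonneg_not_infers_le hw hm (-x) W hint hbd
  rw [two_mul]
  refine (Finset.card_le_card ?_).trans ((Finset.card_union_le _ _).trans (add_le_add h1 h2))
  intro i hi
  simp only [Finset.mem_union, Finset.mem_filter, Finset.mem_univ, true_and] at hi ⊢
  rcases le_total 0 (W i ⬝ᵥ x) with h | h
  · exact Or.inl ⟨h, hi⟩
  · exact Or.inr ⟨by simpa using h, fun h' => hi h'.neg⟩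

/-! ### Counting the faces of a hyperplane arrangement -/

theorem sign_mul_add_mul {a b s t : ℝ} (ha : 0 ≤ a) (hb : 0 ≤ b) (hab : 0 < a + b)
    (h : SignType.sign s = SignType.sign t) : SignType.sign (a * s + b * t) = SignType.sign t := by
  rcases lt_trichotomy t 0 with ht | ht | ht
  · rw [sign_neg ht] at h ⊢
    rw [sign_eq_neg_one_iff] at h ⊢
    rcases ha.eq_or_lt with rfl | ha
    · nlinarith
    · nlinarith [mul_nonneg hb (neg_nonneg.2 ht.le)]
  · rw [ht, sign_zero] at h ⊢
    rw [sign_eq_zero_iff] at h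
    simp [h]
  · rw [sign_pos ht] at h ⊢
    rw [sign_eq_one_iff] at h ⊢
    rcases ha.eq_or_lt with rfl | ha
    · nlinarith
    · nlinarith [mul_nonneg hb ht.le]

theorem abs_mul_add_abs_mul_eq_zero {a b : ℝ} (h : SignType.sign a ≠ SignType.sign b) :
    |b| * a + |a| * b = 0 := by
  rcases lt_trichotomy a 0 with ha | ha | ha <;> rcases lt_trichotomy b 0 with hb | hb | hb <;>
    simp_all [abs_of_neg, abs_of_pos, sign_neg, sign_pos] <;> ring

open Classical in
/-- An arrangement of `m` linear hyperplanes has at most `(3 * m + 1) ^ r` faces in dimension `r`. -/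
theorem exists_sign_representatives {n : ℕ} (D : Finset (Fin n → ℝ)) :
    ∀ V : Submodule ℝ (Fin n → ℝ), ∃ X : Finset (Fin n → ℝ), (∀ x ∈ X, x ∈ V) ∧
      X.card ≤ (3 * D.card + 1) ^ Module.finrank ℝ V ∧
      ∀ y ∈ V, ∃ x ∈ X, ∀ d ∈ D, SignType.sign (d ⬝ᵥ x) = SignType.sign (d ⬝ᵥ y) := by
  induction D using Finset.induction_on with
  | empty => exact fun V => ⟨{0}, by simp, by simp, by simp⟩
  | insert v D hv ih =>
    intro V
    obtain ⟨X₁, hX₁V, hX₁, hX₁y⟩ := ih V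
    rw [Finset.card_insert_of_notMem hv]
    by_cases hvV : ∀ y ∈ V, v ⬝ᵥ y = 0
    · refine ⟨X₁, hX₁V, hX₁.trans (Nat.pow_le_pow_left (by omega) _), fun y hy => ?_⟩
      obtain ⟨x, hx, hxy⟩ := hX₁y y hy
      refine ⟨x, hx, fun d hd => ?_⟩
      rcases Finset.mem_insert.1 hd with rfl | hd
      · rw [hvV x (hX₁V x hx), hvV y hy]
      · exact hxy d hd
    · let φ : (Fin n → ℝ) →ₗ[ℝ] ℝ :=
        { toFun := fun x => v ⬝ᵥ x
          map_add' := fun x y => dotProduct_add v x y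
          map_smul' := fun a x => by simp }
      obtain ⟨X₂, hX₂V, hX₂, hX₂y⟩ := ih (V ⊓ LinearMap.ker φ)
      have hlt : Module.finrank ℝ (V ⊓ LinearMap.ker φ : Submodule ℝ (Fin n → ℝ)) <
          Module.finrank ℝ V := by
        refine Submodule.finrank_lt_finrank_of_lt (lt_of_le_of_ne inf_le_left fun h => hvV ?_)
        intro y hy
        rw [← h] at hy
        exact hy.2
      -- From a representative z of a face within the hyperplane of v, choose a point with the same
      -- signs on D and sign s on v; 0 is a default when none exists. This gives at most three new
      -- points per z.
      have hp : ∀ (z : Fin n → ℝ) (s : SignType), ∃ u ∈ V,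
          (∃ u ∈ V, (∀ d ∈ D, SignType.sign (d ⬝ᵥ u) = SignType.sign (d ⬝ᵥ z)) ∧
            SignType.sign (v ⬝ᵥ u) = s) →
          (∀ d ∈ D, SignType.sign (d ⬝ᵥ u) = SignType.sign (d ⬝ᵥ z)) ∧
            SignType.sign (v ⬝ᵥ u) = s := by
        intro z s
        by_cases h : ∃ u ∈ V, (∀ d ∈ D, SignType.sign (d ⬝ᵥ u) = SignType.sign (d ⬝ᵥ z)) ∧
            SignType.sign (v ⬝ᵥ u) = s
        · obtain ⟨u, hu, h'⟩ := h
          exact ⟨u, hu, fun _ => h'⟩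
        · exact ⟨0, V.zero_mem, fun h' => absurd h' h⟩
      choose p hpV hp using hp
      refine ⟨X₁ ∪ (X₂ ×ˢ Finset.univ).image fun zs => p zs.1 zs.2, fun x hx => ?_, ?_, fun y hy => ?_⟩
      · rcases Finset.mem_union.1 hx with hx | hx
        · exact hX₁V x hx
        · obtain ⟨zs, -, rfl⟩ := Finset.mem_image.1 hx
          exact hpV _ _
      · obtain ⟨k, hk⟩ := Nat.exists_eq_add_of_lt hlt
        set r := Module.finrank ℝ (V ⊓ LinearMap.ker φ : Submodule ℝ (Fin n → ℝ))
        have h3 : ((X₂ ×ˢ (Finset.univ : Finset SignType)).image fun zs => p zs.1 zs.2).card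
            ≤ X₂.card * 3 := by
          refine Finset.card_image_le.trans ?_
          rw [Finset.card_product]
          exact Nat.mul_le_mul_left _ (le_of_eq rfl)
        have h4 : (3 * D.card + 1) ^ r ≤ (3 * D.card + 1) ^ (r + k) :=
          Nat.pow_le_pow_right (by omega) (by omega)
        have h5 : (3 * D.card + 1) ^ (r + k) ≤ (3 * (D.card + 1) + 1) ^ (r + k) :=
          Nat.pow_le_pow_left (by omega) _
        calc _ ≤ X₁.card + X₂.card * 3 := (Finset.card_union_le _ _).trans (by omega)
          _ ≤ (3 * D.card + 1) ^ (r + k + 1) + (3 * D.card + 1) ^ (r + k) * 3 := by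
              rw [hk] at hX₁
              exact add_le_add hX₁ (Nat.mul_le_mul_right _ (hX₂.trans h4))
          _ = (3 * D.card + 1) ^ (r + k) * (3 * (D.card + 1) + 1) := by ring
          _ ≤ (3 * (D.card + 1) + 1) ^ (r + k) * (3 * (D.card + 1) + 1) :=
              Nat.mul_le_mul_right _ h5
          _ = _ := by rw [hk, pow_succ]
      · obtain ⟨x, hx, hxy⟩ := hX₁y y hy
        by_cases hs : SignType.sign (v ⬝ᵥ x) = SignType.sign (v ⬝ᵥ y)
        · refine ⟨x, Finset.mem_union_left _ hx, fun d hd => ?_⟩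
          rcases Finset.mem_insert.1 hd with rfl | hd
          · exact hs
          · exact hxy d hd
        · have hpos : 0 < |v ⬝ᵥ y| + |v ⬝ᵥ x| := by
            refine lt_of_le_of_ne (by positivity) fun h => hs ?_
            have h1 := abs_nonneg (v ⬝ᵥ y)
            have h2 := abs_nonneg (v ⬝ᵥ x)
            rw [abs_eq_zero.1 (show |v ⬝ᵥ y| = 0 by linarith),
              abs_eq_zero.1 (show |v ⬝ᵥ x| = 0 by linarith)]
          -- The positive multiple of the point where the segment from x to y meets the hyperplane
          -- of v; it keeps the common signs on D.
          obtain ⟨z, hz, hzy⟩ := hX₂y (|v ⬝ᵥ y| • x + |v ⬝ᵥ x| • y) ⟨V.add_mem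
            (V.smul_mem _ (hX₁V x hx)) (V.smul_mem _ hy), by
              simpa [φ] using abs_mul_add_abs_mul_eq_zero hs⟩
          have hyz : ∀ d ∈ D, SignType.sign (d ⬝ᵥ y) = SignType.sign (d ⬝ᵥ z) := by
            intro d hd
            rw [hzy d hd, dotProduct_add, dotProduct_smul, dotProduct_smul, smul_eq_mul, smul_eq_mul,
              sign_mul_add_mul (abs_nonneg _) (abs_nonneg _) hpos (hxy d hd)]
          obtain ⟨h1, h2⟩ := hp z (SignType.sign (v ⬝ᵥ y)) ⟨y, hy, hyz, rfl⟩
          refine ⟨p z (SignType.sign (v ⬝ᵥ y)), Finset.mem_union_right _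
            (Finset.mem_image.2 ⟨(z, SignType.sign (v ⬝ᵥ y)), by simp [hz], rfl⟩), fun d hd => ?_⟩
          rcases Finset.mem_insert.1 hd with rfl | hd
          · exact h2
          · rw [h1 d hd, hyz d hd]

/-! ### Trees that are correct on a finite set of inputs -/

/-- Some comparison decision tree for `H` is correct on `X` and makes at most `q` queries there. -/
def Solvable {n : ℕ} (H X : Finset (Fin n → ℝ)) (q : ℝ) : Prop :=
  ∃ T : LinearDecisionTree n (H → SignType), T.IsComparison H ∧
    ∀ x ∈ X, T.eval x = signVector H x ∧ (T.numQueries x : ℝ) ≤ q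

namespace Solvable

variable {n : ℕ} {H X Y : Finset (Fin n → ℝ)} {q q' : ℝ}

theorem mono (h : Solvable H X q) (hYX : Y ⊆ X) (hq : q ≤ q') : Solvable H Y q' := by
  obtain ⟨T, hT, hX⟩ := h
  exact ⟨T, hT, fun x hx => ⟨(hX x (hYX hx)).1, (hX x (hYX hx)).2.trans hq⟩⟩

theorem of_forall_signVector_eq (hX : ∀ x ∈ X, ∀ y ∈ X, signVector H x = signVector H y)
    (hq : 0 ≤ q) : Solvable H X q := by
  rcases X.eq_empty_or_nonempty with rfl | ⟨x, hx⟩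
  · exact ⟨.leaf fun _ => 0, trivial, by simp⟩
  · exact ⟨.leaf (signVector H x), trivial, fun y hy =>
      ⟨hX x hx y hy, by simpa [LinearDecisionTree.numQueries] using hq⟩⟩

theorem empty : Solvable H ∅ q :=
  ⟨.leaf fun _ => 0, trivial, by simp⟩

open Classical in
theorem node {v : Fin n → ℝ} (hv : v ∈ H ∨ ∃ h' ∈ H, ∃ h'' ∈ H, v = h' - h'')
    (h : ∀ s, Solvable H (X.filter fun x => SignType.sign (v ⬝ᵥ x) = s) q) :
    Solvable H X (q + 1) := by
  choose T hT hX using h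
  refine ⟨.node v T, ⟨hv, hT⟩, fun x hx => ?_⟩
  have := hX (SignType.sign (v ⬝ᵥ x)) x (Finset.mem_filter.2 ⟨hx, rfl⟩)
  refine ⟨this.1, ?_⟩
  simp only [LinearDecisionTree.numQueries]
  push_cast
  linarith [this.2]

open Classical in
theorem compare {w t : Fin n → ℝ} (hw : w ∈ H) (ht : t = 0 ∨ t ∈ H)
    (hlt : Solvable H (X.filter fun x => w ⬝ᵥ x < t ⬝ᵥ x) q)
    (heq : Solvable H (X.filter fun x => w ⬝ᵥ x = t ⬝ᵥ x) q)
    (hgt : Solvable H (X.filter fun x => t ⬝ᵥ x < w ⬝ᵥ x) q) : Solvable H X (q + 1) := by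
  refine node (v := w - t) ?_ fun s => ?_
  · rcases ht with rfl | ht
    · exact Or.inl (by simpa using hw)
    · exact Or.inr ⟨w, hw, t, ht, rfl⟩
  · cases s
    · refine heq.mono (fun x hx => ?_) le_rfl
      simp only [Finset.mem_filter, SignType.zero_eq_zero, sign_eq_zero_iff, sub_dotProduct] at hx ⊢
      exact ⟨hx.1, by linarith [hx.2]⟩
    · refine hlt.mono (fun x hx => ?_) le_rfl
      simp only [Finset.mem_filter, SignType.neg_eq_neg_one, sign_eq_neg_one_iff, sub_dotProduct]
        at hx ⊢
      exact ⟨hx.1, by linarith [hx.2]⟩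
    · refine hgt.mono (fun x hx => ?_) le_rfl
      simp only [Finset.mem_filter, SignType.pos_eq_one, sign_eq_one_iff, sub_dotProduct] at hx ⊢
      exact ⟨hx.1, by linarith [hx.2]⟩

open Classical in
/-- Compare `w` with the largest element of `A`. -/
theorem compare_max {A : Finset (Fin n → ℝ)} {w : Fin n → ℝ} (hw : w ∈ H)
    (hA : ∀ t ∈ A, t = 0 ∨ t ∈ H) (hX : ∀ x ∈ X, ∀ y ∈ X, SameOrder (A : Set (Fin n → ℝ)) x y)
    (hlt : ∀ t ∈ A, Solvable H (X.filter fun x => w ⬝ᵥ x < t ⬝ᵥ x) q)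
    (heq : ∀ t ∈ A, Solvable H (X.filter fun x => w ⬝ᵥ x = t ⬝ᵥ x) q)
    (hgt : Solvable H (X.filter fun x => ∀ t ∈ A, t ⬝ᵥ x < w ⬝ᵥ x) q) : Solvable H X (q + 1) := by
  rcases A.eq_empty_or_nonempty with rfl | hne
  · exact hgt.mono (fun x hx => by simp [hx]) (by linarith)
  rcases X.eq_empty_or_nonempty with rfl | ⟨x, hx⟩
  · exact empty
  obtain ⟨a, ha, hmax⟩ := A.exists_max_image (fun t => t ⬝ᵥ x) hne
  refine compare hw (hA a ha) (hlt a ha) (heq a ha) (hgt.mono (fun y hy => ?_) le_rfl)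
  rw [Finset.mem_filter] at hy ⊢
  exact ⟨hy.1, fun t ht => (((hX x hx y hy.1).le_iff ht ha).1 (hmax t ht)).trans_lt hy.2⟩

open Classical in
/-- Compare `w` with the smallest element of `A`. -/
theorem compare_min {A : Finset (Fin n → ℝ)} {w : Fin n → ℝ} (hw : w ∈ H)
    (hA : ∀ t ∈ A, t = 0 ∨ t ∈ H) (hX : ∀ x ∈ X, ∀ y ∈ X, SameOrder (A : Set (Fin n → ℝ)) x y)
    (hgt : ∀ t ∈ A, Solvable H (X.filter fun x => t ⬝ᵥ x < w ⬝ᵥ x) q)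
    (heq : ∀ t ∈ A, Solvable H (X.filter fun x => w ⬝ᵥ x = t ⬝ᵥ x) q)
    (hlt : Solvable H (X.filter fun x => ∀ t ∈ A, w ⬝ᵥ x < t ⬝ᵥ x) q) : Solvable H X (q + 1) := by
  rcases A.eq_empty_or_nonempty with rfl | hne
  · exact hlt.mono (fun x hx => by simp [hx]) (by linarith)
  rcases X.eq_empty_or_nonempty with rfl | ⟨x, hx⟩
  · exact empty
  obtain ⟨a, ha, hmin⟩ := A.exists_min_image (fun t => t ⬝ᵥ x) hne
  refine compare hw (hA a ha) (hlt.mono (fun y hy => ?_) le_rfl) (heq a ha) (hgt a ha)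
  rw [Finset.mem_filter] at hy ⊢
  exact ⟨hy.1, fun t ht => hy.2.trans_le (((hX x hx y hy.1).le_iff ha ht).1 (hmin t ht))⟩

end Solvable

/-! ### Weighted binary search and insertion sort -/

theorem SameOrder.insert {n : ℕ} {T : Set (Fin n → ℝ)} {w x y : Fin n → ℝ} (h : SameOrder T x y)
    (hlt : ∀ t ∈ T, w ⬝ᵥ x < t ⬝ᵥ x ↔ w ⬝ᵥ y < t ⬝ᵥ y)
    (hgt : ∀ t ∈ T, t ⬝ᵥ x < w ⬝ᵥ x ↔ t ⬝ᵥ y < w ⬝ᵥ y) : SameOrder (insert w T) x y := by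
  rintro s (rfl | hs) t (rfl | ht)
  · simp
  · exact hlt t ht
  · exact hgt s hs
  · exact h s hs t ht

theorem logb_add_one_le_of_two_mul_le {a b : ℕ} (ha : 0 < a) (h : 2 * a ≤ b) :
    Real.logb 2 a + 1 ≤ Real.logb 2 b := by
  have h1 : (0 : ℝ) < a := by exact_mod_cast ha
  have h2 : ((2 * a : ℕ) : ℝ) ≤ b := by exact_mod_cast h
  push_cast at h2
  have h3 := Real.logb_le_logb_of_le (b := 2) (by norm_num) (by positivity) h2
  rw [Real.logb_mul (by norm_num) h1.ne', Real.logb_self_eq_one (by norm_num)] at h3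
  linarith

theorem logb_natCast_le_of_le {a b : ℕ} (h : a ≤ b) : Real.logb 2 a ≤ Real.logb 2 b := by
  rcases Nat.eq_zero_or_pos a with rfl | ha
  · rcases Nat.eq_zero_or_pos b with rfl | hb
    · simp
    · simpa using Real.logb_nonneg (b := 2) (by norm_num) (Nat.one_le_cast.2 hb)
  · exact Real.logb_le_logb_of_le (by norm_num) (by exact_mod_cast ha) (by exact_mod_cast h)

open Classical in
/-- Inserting `w` into an ordered set by binary search, weighted by the number of inputs that are
still possible. -/
theorem Solvable.of_insert {n : ℕ} {H T : Finset (Fin n → ℝ)} {w : Fin n → ℝ} {Q : ℝ} (hw : w ∈ H)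
    (hT : ∀ t ∈ T, t = 0 ∨ t ∈ H) (X : Finset (Fin n → ℝ))
    (hX : ∀ x ∈ X, ∀ y ∈ X, SameOrder (T : Set (Fin n → ℝ)) x y)
    (hk : ∀ Y ⊆ X, (∀ x ∈ Y, ∀ y ∈ Y, SameOrder (insert w T : Set (Fin n → ℝ)) x y) →
      Solvable H Y (Q + 2 * Real.logb 2 Y.card)) :
    Solvable H X (Q + 2 + 2 * Real.logb 2 X.card) := by
  induction hc : X.card using Nat.strong_induction_on generalizing X with
  | _ c ih =>
    subst hc
    -- Halving the inputs lowers 2 log|X| by 2, which pays for the two queries of this round.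
    have hF : ∀ Y ⊆ X, 2 * Y.card ≤ X.card → Solvable H Y (Q + 2 * Real.logb 2 X.card) := by
      intro Y hY hcard
      rcases Y.eq_empty_or_nonempty with rfl | hne
      · exact .empty
      have hpos := hne.card_pos
      refine (ih Y.card (by omega) Y (fun x hx y hy => hX x (hY hx) y (hY hy))
        (fun Z hZ => hk Z (hZ.trans hY)) rfl).mono subset_rfl ?_
      linarith [logb_add_one_le_of_two_mul_le hpos hcard]
    have hG : ∀ Y ⊆ X, (∀ t ∈ T, (∀ x ∈ Y, w ⬝ᵥ x < t ⬝ᵥ x) ∨ (∀ x ∈ Y, w ⬝ᵥ x = t ⬝ᵥ x) ∨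
        (∀ x ∈ Y, t ⬝ᵥ x < w ⬝ᵥ x)) → Solvable H Y (Q + 2 * Real.logb 2 X.card) := by
      intro Y hY h
      refine (hk Y hY fun x hx y hy => (hX x (hY hx) y (hY hy)).insert (fun t ht => ?_)
        fun t ht => ?_).mono subset_rfl ?_
      · rcases h t ht with h | h | h
        · simp [h x hx, h y hy]
        · simp [h x hx, h y hy]
        · exact iff_of_false (h x hx).not_gt (h y hy).not_gt
      · rcases h t ht with h | h | h
        · exact iff_of_false (h x hx).not_gt (h y hy).not_gt
        · simp [h x hx, h y hy]
        · simp [h x hx, h y hy]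
      · linarith [logb_natCast_le_of_le (Finset.card_le_card hY)]
    have hE : ∀ Y ⊆ X, ∀ a ∈ T, Solvable H (Y.filter fun x => w ⬝ᵥ x = a ⬝ᵥ x)
        (Q + 2 * Real.logb 2 X.card) := by
      intro Y hY a ha
      refine hG _ ((Finset.filter_subset _ _).trans hY) fun t ht => ?_
      simp only [Finset.mem_filter]
      rcases Y.eq_empty_or_nonempty with rfl | ⟨z, hz⟩
      · simp
      rcases lt_trichotomy (a ⬝ᵥ z) (t ⬝ᵥ z) with h | h | h
      · exact Or.inl fun x hx => by
          rw [hx.2]; exact (hX z (hY hz) x (hY hx.1) a ha t ht).1 h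
      · refine Or.inr (Or.inl fun x hx => ?_)
        have h1 := hX z (hY hz) x (hY hx.1)
        rw [hx.2]
        exact le_antisymm ((h1.le_iff ha ht).1 h.le) ((h1.le_iff ht ha).1 h.ge)
      · exact Or.inr (Or.inr fun x hx => by
          rw [hx.2]; exact (hX z (hY hz) x (hY hx.1) t ht a ha).1 h)
    -- A is an initial segment of the common order and B its complement. Landing below max A or
    -- above min B leaves at most half of the inputs; every other outcome fixes the place of w.
    let A := T.filter fun t => 2 * (X.filter fun x => w ⬝ᵥ x < t ⬝ᵥ x).card ≤ X.card
    let B := T.filter fun t => ¬ 2 * (X.filter fun x => w ⬝ᵥ x < t ⬝ᵥ x).card ≤ X.card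
    have hAT : A ⊆ T := Finset.filter_subset _ _
    have hBT : B ⊆ T := Finset.filter_subset _ _
    have h2 : Q + 2 + 2 * Real.logb 2 X.card = (Q + 2 * Real.logb 2 X.card + 1) + 1 := by ring
    rw [h2]
    refine Solvable.compare_max (A := A) hw (fun t ht => hT t (hAT ht))
      (fun x hx y hy => (hX x hx y hy).mono (Finset.coe_subset.2 hAT)) (fun t ht => ?_)
      (fun t ht => ?_) ?_
    · exact (hF _ (Finset.filter_subset _ _) (Finset.mem_filter.1 ht).2).mono subset_rfl (by linarith)
    · exact (hE X subset_rfl t (hAT ht)).mono subset_rfl (by linarith)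
    · have hX' : (X.filter fun x => ∀ t ∈ A, t ⬝ᵥ x < w ⬝ᵥ x) ⊆ X := Finset.filter_subset _ _
      refine Solvable.compare_min (A := B) hw (fun t ht => hT t (hBT ht))
        (fun x hx y hy => (hX x (hX' hx) y (hX' hy)).mono (Finset.coe_subset.2 hBT)) (fun t ht => ?_)
        (fun t ht => hE _ hX' t (hBT ht)) ?_
      · refine (hF (X.filter fun x => ¬ w ⬝ᵥ x < t ⬝ᵥ x) (Finset.filter_subset _ _) ?_).mono
          (fun x hx => ?_) le_rfl
        · have h3 := (Finset.mem_filter.1 ht).2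
          have h4 := Finset.card_filter_add_card_filter_not (s := X) fun x => w ⬝ᵥ x < t ⬝ᵥ x
          omega
        · rw [Finset.mem_filter] at hx ⊢
          exact ⟨hX' hx.1, hx.2.le.not_gt⟩
      · refine hG _ ((Finset.filter_subset _ _).trans hX') fun t ht => ?_
        simp only [Finset.mem_filter]
        by_cases htA : t ∈ A
        · exact Or.inr (Or.inr fun x hx => hx.1.2 t htA)
        · exact Or.inl fun x hx => hx.2 t (Finset.mem_filter.2 ⟨ht, fun h =>
            htA (Finset.mem_filter.2 ⟨ht, h⟩)⟩)

open Classical in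
/-- Sorting the entries of a list by successive insertion. -/
theorem Solvable.of_list {n : ℕ} {H : Finset (Fin n → ℝ)} (l : List (Fin n → ℝ))
    (hl : ∀ w ∈ l, w ∈ H) {T : Finset (Fin n → ℝ)} {Q : ℝ} (hT : ∀ t ∈ T, t = 0 ∨ t ∈ H)
    (X : Finset (Fin n → ℝ)) (hX : ∀ x ∈ X, ∀ y ∈ X, SameOrder (T : Set (Fin n → ℝ)) x y)
    (hk : ∀ Y ⊆ X, (∀ x ∈ Y, ∀ y ∈ Y, SameOrder (T ∪ {w | w ∈ l} : Set (Fin n → ℝ)) x y) →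
      Solvable H Y (Q + 2 * Real.logb 2 Y.card)) :
    Solvable H X (Q + 2 * l.length + 2 * Real.logb 2 X.card) := by
  induction l generalizing T X with
  | nil =>
    refine (hk X subset_rfl (by simpa using hX)).mono subset_rfl (by simp)
  | cons w l ih =>
    have h1 : Q + 2 * (w :: l).length = (Q + 2 * l.length) + 2 := by
      simp only [List.length_cons]; push_cast; ring
    rw [h1]
    have hw := hl w (by simp)
    refine Solvable.of_insert hw hT X hX fun Y hY hYs => ?_
    refine ih (fun u hu => hl u (by simp [hu])) (T := insert w T) ?_ Y ?_ ?_
    · intro t ht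
      rcases Finset.mem_insert.1 ht with rfl | ht
      · exact Or.inr hw
      · exact hT t ht
    · simpa using hYs
    · intro Z hZ hZs
      refine hk Z (hZ.trans hY) fun x hx y hy => (hZs x hx y hy).mono ?_
      rintro u (hu | hu)
      · exact Or.inl (by simp [Finset.mem_coe.1 hu])
      · rcases List.mem_cons.1 hu with rfl | hu
        · exact Or.inl (by simp)
        · exact Or.inr hu

/-! ### The potential argument -/

open Classical in
theorem exists_sequence_card_few_inferred_le {n m M : ℕ} {w : ℝ} (hw : 0 ≤ w)
    (hm : (4 * w * m + 1) ^ n < 2 ^ m) (hM : 16 * m ≤ M) {R : Finset (Fin n → ℝ)}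
    (hR : R.Nonempty) (hint : ∀ h ∈ R, ∀ i, ∃ k : ℤ, h i = k) (hbd : ∀ h ∈ R, ‖h‖ ≤ w)
    (X : Finset (Fin n → ℝ)) :
    ∃ W : Fin (2 * M) → Fin n → ℝ, (∀ j, W j ∈ R) ∧
      ((X.filter fun x => ((R.filter (Infers x (Set.range W))).card : ℝ) ≤
        1 / 64 * R.card).card : ℝ) ≤ (2 / 3) ^ M * X.card := by
  have : Nonempty R := hR.to_subtype
  obtain ⟨W, hW⟩ := exists_card_filter_le_of_forall_card_le (ι := Fin (2 * M) → R) X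
    (fun W x => ((Finset.univ.filter fun a : R =>
      Infers x (Subtype.val '' Set.range W) a).card : ℝ) ≤ 1 / 64 * Fintype.card R)
    (ρ := (2 / 3) ^ M) fun x _ => by
      have h := card_few_inferred_le (α := R)
        (I := fun S a => Infers x (Subtype.val '' S) a)
        (fun S T a hST h => h.mono (Set.image_mono hST)) (d := 2 * m) (M := M) (by omega)
        fun k V => by
          have := card_not_infers_le hw hm x (fun i => (V i : Fin n → ℝ))
            (fun j => hint _ (V j).2) fun j => hbd _ (V j).2
          simpa only [Set.image_image] using this
      simpa using h
  refine ⟨fun j => W j, fun j => (W j).2, ?_⟩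
  have hcard : ∀ x, (Finset.univ.filter fun a : R =>
      Infers x (Subtype.val '' Set.range W) a).card =
      (R.filter (Infers x (Set.range fun j => (W j : Fin n → ℝ)))).card := by
    intro x
    rw [← Finset.card_map (Function.Embedding.subtype _)]
    congr 1
    ext a
    simp [← Set.range_comp, Function.comp_def, and_comm]
  simpa only [hcard, Fintype.card_coe] using hW

open Classical in
/-- The elements of `H` whose label is not constant on `X`. -/
noncomputable def unresolved {n : ℕ} (H X : Finset (Fin n → ℝ)) : Finset (Fin n → ℝ) :=
  H.filter fun h => ∃ x ∈ X, ∃ y ∈ X, SignType.sign (h ⬝ᵥ x) ≠ SignType.sign (h ⬝ᵥ y)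

theorem logb_one_add_add_le {r s : ℕ} (hr : 0 < r) (h : (s : ℝ) ≤ 63 / 64 * r) :
    Real.logb 2 (1 + s) + Real.logb 2 (128 / 127) ≤ Real.logb 2 (1 + r) := by
  have h1 : (1 : ℝ) ≤ r := by exact_mod_cast hr
  have h2 : (0 : ℝ) ≤ s := by positivity
  rw [← Real.logb_mul (by positivity) (by norm_num)]
  exact Real.logb_le_logb_of_le (by norm_num) (by positivity) (by linarith)

theorem logb_add_half_mul_le {a b M : ℕ} (ha : 0 < a) (h : (a : ℝ) ≤ (2 / 3) ^ M * b) :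
    Real.logb 2 a + 1 / 2 * M ≤ Real.logb 2 b := by
  have ha' : (0 : ℝ) < a := by exact_mod_cast ha
  have hb : (0 : ℝ) < b := by
    by_contra hb
    have h1 : (b : ℝ) = 0 := le_antisymm (not_lt.1 hb) (by positivity)
    rw [h1, mul_zero] at h
    linarith
  have h1 := Real.logb_le_logb_of_le (b := 2) (by norm_num) ha' h
  rw [Real.logb_mul (by positivity) hb.ne', Real.logb_pow] at h1
  have h2 : Real.logb 2 (2 / 3) ≤ -(1 / 2) := by
    rw [Real.logb_le_iff_le_rpow (by norm_num) (by norm_num), Real.rpow_neg (by norm_num),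
      ← Real.sqrt_eq_rpow, div_eq_mul_inv, ← div_eq_mul_inv, le_inv_comm₀ (by norm_num) (by positivity)]
    rw [Real.sqrt_le_left (by norm_num)]
    norm_num
  nlinarith [mul_le_mul_of_nonneg_left h2 (show (0 : ℝ) ≤ M by positivity)]

-- Sorting 2M forms costs 4M beyond the 2 log(|X|/|Y|) charged to the shrinking of X. The remaining
-- 8 log|X| pays 4M when X shrinks by (2/3)^M, since log₂(3/2) ≥ 1/2; otherwise the term with A pays
-- it.
open Classical in
theorem solvable_of_potential {n m M : ℕ} {w : ℝ} (hw : 0 ≤ w)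
    (hm : (4 * w * m + 1) ^ n < 2 ^ m) (hM : 16 * m ≤ M) (hM0 : 0 < M) {H : Finset (Fin n → ℝ)}
    (hint : ∀ h ∈ H, ∀ i, ∃ k : ℤ, h i = k) (hbd : ∀ h ∈ H, ‖h‖ ≤ w) {A : ℝ}
    (hA0 : 0 ≤ A) (hA : 4 * M ≤ A * Real.logb 2 (128 / 127)) (X : Finset (Fin n → ℝ)) :
    Solvable H X (A * Real.logb 2 (1 + (unresolved H X).card) + 10 * Real.logb 2 X.card) := by
  induction hc : X.card using Nat.strong_induction_on generalizing X with
  | _ c ih =>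
    subst hc
    have hlog : ∀ r : ℕ, 0 ≤ Real.logb 2 (1 + r) := fun r =>
      Real.logb_nonneg (by norm_num) (by simp)
    have hlogX : ∀ r : ℕ, 0 ≤ Real.logb 2 r := fun r => by
      simpa using logb_natCast_le_of_le (Nat.zero_le r)
    rcases (unresolved H X).eq_empty_or_nonempty with hR | hR
    · refine .of_forall_signVector_eq (fun x hx y hy => funext fun h => ?_)
        (add_nonneg (mul_nonneg hA0 (hlog _)) (mul_nonneg (by norm_num) (hlogX _)))
      by_contra hne
      have : (h : Fin n → ℝ) ∈ unresolved H X :=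
        Finset.mem_filter.2 ⟨h.2, x, hx, y, hy, hne⟩
      simp [hR] at this
    set R := unresolved H X with hRdef
    have hRH : R ⊆ H := Finset.filter_subset _ _
    obtain ⟨W, hWR, hW⟩ := exists_sequence_card_few_inferred_le hw hm hM hR
      (fun h hh => hint h (hRH hh)) (fun h hh => hbd h (hRH hh)) X
    have hQ : A * Real.logb 2 (1 + R.card) + 10 * Real.logb 2 X.card =
        (A * Real.logb 2 (1 + R.card) + 8 * Real.logb 2 X.card - 4 * M) +
          2 * (List.ofFn W).length + 2 * Real.logb 2 X.card := by
      rw [List.length_ofFn]; push_cast; ring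
    rw [hQ]
    refine Solvable.of_list (List.ofFn W) (fun u hu => ?_) (T := {0}) (by simp) X ?_ ?_
    · obtain ⟨j, rfl⟩ := (List.mem_ofFn' _ _).1 hu
      exact hRH (hWR j)
    · intro x _ y _ s hs t ht
      simp_all
    intro Y hYX hY
    have hsort : ∀ x ∈ Y, ∀ y ∈ Y, SameOrder (insert 0 (Set.range W)) x y := by
      intro x hx y hy
      refine (hY x hx y hy).mono ?_
      rintro u (rfl | ⟨j, rfl⟩)
      · simp
      · exact Or.inr ((List.mem_ofFn' _ _).2 ⟨j, rfl⟩)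
    rcases Y.eq_empty_or_nonempty with rfl | hne
    · exact .empty
    -- The label of W 0 varies on X but is constant on Y; here M > 0 is needed.
    have hlt : Y.card < X.card := by
      refine Finset.card_lt_card (hYX.ssubset_of_ne ?_)
      rintro rfl
      obtain ⟨-, x, hx, y, hy, hxy⟩ := Finset.mem_filter.1 (hWR ⟨0, by omega⟩)
      exact hxy (infers_of_mem (Set.mem_range_self _) x (hsort y hy x hx))
    have hRY : ∀ y ∈ Y, unresolved H Y ⊆ R.filter fun h => ¬ Infers y (Set.range W) h := by
      intro y hy h hh
      obtain ⟨hH, x, hx, z, hz, hxz⟩ := Finset.mem_filter.1 hh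
      refine Finset.mem_filter.2 ⟨Finset.mem_filter.2 ⟨hH, x, hYX hx, z, hYX hz, hxz⟩, fun hI => hxz ?_⟩
      rw [hI x (hsort y hy x hx), hI z (hsort y hy z hz)]
    refine (ih Y.card hlt Y rfl).mono subset_rfl ?_
    have hYlog := logb_natCast_le_of_le (Finset.card_le_card hYX)
    -- One good y suffices, since all inputs in Y order W and 0 alike.
    by_cases hgood : ∃ y ∈ Y, 1 / 64 * (R.card : ℝ) < (R.filter (Infers y (Set.range W))).card
    · obtain ⟨y, hy, hlt⟩ := hgood
      have h1 : ((unresolved H Y).card : ℝ) ≤ (R.filter fun h => ¬ Infers y (Set.range W) h).card := by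
        exact_mod_cast Finset.card_le_card (hRY y hy)
      have h2 : ((R.filter (Infers y (Set.range W))).card : ℝ) +
          (R.filter fun h => ¬ Infers y (Set.range W) h).card = R.card := by
        exact_mod_cast Finset.card_filter_add_card_filter_not (s := R) (Infers y (Set.range W))
      have h3 := logb_one_add_add_le (s := (unresolved H Y).card) hR.card_pos (by linarith)
      have h4 := mul_le_mul_of_nonneg_left h3 hA0
      linarith
    · push Not at hgood
      have h1 : (Y.card : ℝ) ≤ (2 / 3) ^ M * X.card := by
        refine le_trans ?_ hW
        exact_mod_cast Finset.card_le_card fun y hy =>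
          Finset.mem_filter.2 ⟨hYX hy, hgood y hy⟩
      have h2 := logb_add_half_mul_le hne.card_pos h1
      have h3 : Real.logb 2 (1 + (unresolved H Y).card) ≤ Real.logb 2 (1 + R.card) := by
        obtain ⟨y, hy⟩ := hne
        have h4 := Finset.card_le_card ((hRY y hy).trans (Finset.filter_subset _ _))
        have h5 : ((unresolved H Y).card : ℝ) ≤ R.card := by exact_mod_cast h4
        exact Real.logb_le_logb_of_le (by norm_num) (by positivity) (by linarith)
      have h4 := mul_le_mul_of_nonneg_left h3 hA0
      linarith

/-! ### From face representatives to all inputs -/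

theorem LinearDecisionTree.IsComparison.eval_eq_and_numQueries_eq {n : ℕ} {α : Type}
    {H : Finset (Fin n → ℝ)} {x y : Fin n → ℝ}
    (hxy : ∀ v : Fin n → ℝ, (v ∈ H ∨ ∃ h' ∈ H, ∃ h'' ∈ H, v = h' - h'') →
      SignType.sign (v ⬝ᵥ x) = SignType.sign (v ⬝ᵥ y)) :
    ∀ T : LinearDecisionTree n α, T.IsComparison H →
      T.eval x = T.eval y ∧ T.numQueries x = T.numQueries y := by
  intro T
  induction T with
  | leaf => exact fun _ => ⟨rfl, rfl⟩
  | node v next ih =>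
    intro hT
    have h := ih (SignType.sign (v ⬝ᵥ y)) (hT.2 _)
    simp only [eval, numQueries, hxy v hT.1, h.1, h.2, and_self]

open Classical in
theorem exists_comparison_representatives {n : ℕ} {H : Finset (Fin n → ℝ)} (hH : 2 ≤ H.card) :
    ∃ X : Finset (Fin n → ℝ), X.card ≤ H.card ^ (5 * n) ∧
      ∀ y, ∃ x ∈ X, ∀ v : Fin n → ℝ, (v ∈ H ∨ ∃ h' ∈ H, ∃ h'' ∈ H, v = h' - h'') →
        SignType.sign (v ⬝ᵥ y) = SignType.sign (v ⬝ᵥ x) := by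
  let D := H ∪ (H ×ˢ H).image fun p => p.1 - p.2
  obtain ⟨X, -, hX, hXy⟩ := exists_sign_representatives D ⊤
  refine ⟨X, ?_, fun y => ?_⟩
  · rw [finrank_top, Module.finrank_fin_fun] at hX
    rw [pow_mul]
    refine hX.trans (Nat.pow_le_pow_left ?_ n)
    have h1 : D.card ≤ H.card + H.card * H.card := by
      refine (Finset.card_union_le _ _).trans (Nat.add_le_add_left ?_ _)
      exact Finset.card_image_le.trans (Finset.card_product _ _).le
    have h2 : 4 ≤ H.card * H.card := by nlinarith
    have h3 : H.card * H.card * 8 ≤ H.card ^ 5 := by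
      calc _ = H.card * H.card * 2 ^ 3 := by norm_num
        _ ≤ H.card * H.card * H.card ^ 3 := Nat.mul_le_mul_left _ (Nat.pow_le_pow_left hH 3)
        _ = _ := by ring
    nlinarith
  · obtain ⟨x, hx, h⟩ := hXy y trivial
    refine ⟨x, hx, fun v hv => (h v ?_).symm⟩
    rcases hv with hv | ⟨a, ha, b, hb, rfl⟩
    · exact Finset.mem_union_left _ hv
    · exact Finset.mem_union_right _ (Finset.mem_image.2 ⟨(a, b), Finset.mem_product.2 ⟨ha, hb⟩, rfl⟩)

/-- With m = 16nL the base is 64(nw)L + 1 ≤ 2^(9L), and 9 < 16. -/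
theorem pow_lt_two_pow_of_le_two_pow {n L : ℕ} {w : ℝ} (hw : 0 ≤ w) (hn : 0 < n) (hL : 0 < L)
    (h : n * w ≤ 2 ^ L) : (4 * w * (16 * n * L : ℕ) + 1) ^ n < (2 : ℝ) ^ (16 * n * L) := by
  have h1 : (L : ℝ) ≤ 2 ^ L := by exact_mod_cast Nat.lt_two_pow_self.le
  have h2 : (1 : ℝ) ≤ 2 ^ L := one_le_pow₀ (by norm_num)
  have h3 : (n * w) * L ≤ 2 ^ L * (2 : ℝ) ^ L := mul_le_mul h h1 (by positivity) (by positivity)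
  have h4 : (2 : ℝ) ^ 7 ≤ (2 ^ L) ^ 7 := pow_le_pow_left₀ (by norm_num)
    (le_self_pow₀ (by norm_num) hL.ne') 7
  have h5 : (4 * w * (16 * n * L : ℕ) + 1 : ℝ) ≤ 2 ^ (9 * L) := by
    calc (4 * w * (16 * n * L : ℕ) + 1 : ℝ) = 64 * ((n * w) * L) + 1 := by push_cast; ring
      _ ≤ 2 ^ 7 * (2 ^ L * (2 : ℝ) ^ L) := by nlinarith
      _ ≤ (2 ^ L) ^ 7 * (2 ^ L * (2 : ℝ) ^ L) := mul_le_mul_of_nonneg_right h4 (by positivity)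
      _ = _ := by rw [mul_comm 9, pow_mul]; ring
  calc _ ≤ ((2 : ℝ) ^ (9 * L)) ^ n := pow_le_pow_left₀ (by positivity) h5 n
    _ = 2 ^ (9 * L * n) := (pow_mul _ _ _).symm
    _ < _ := pow_lt_pow_right₀ (by norm_num) (by nlinarith [Nat.mul_pos hn hL])

/-- The norm on `Fin n → ℝ` is the sup norm. -/
theorem mainTheorem1 :
    ∃ C : ℝ, 0 < C ∧
      ∀ (n : ℕ) (w : ℝ) (H : Finset (Fin n → ℝ)),
        (∀ h ∈ H, ∀ i, ∃ k : ℤ, h i = (k : ℝ)) →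
        (∀ h ∈ H, ‖h‖ ≤ w) →
        2 ≤ (n : ℝ) * w →
        2 ≤ H.card →
        ∃ T : LinearDecisionTree n (H → SignType),
          T.IsComparison H ∧
          T.Computes (signVector H) ∧
          T.QueryComplexityLE
            (C * ((n : ℝ) * Real.log ((n : ℝ) * w) * Real.log (H.card : ℝ))) := by
  set κ := Real.logb 2 (128 / 127) with hκdef
  have hκ : 0 < κ := Real.logb_pos (by norm_num) (by norm_num)
  have hlog2 : 0 < Real.log 2 := Real.log_pos (by norm_num)
  refine ⟨(4096 / κ + 50) / (Real.log 2 * Real.log 2), by positivity, ?_⟩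
  intro n w H hint hbd hnw hH
  have hn : 0 < n := by
    rcases Nat.eq_zero_or_pos n with rfl | hn
    · norm_num at hnw
    · exact hn
  have hw : 0 ≤ w := by
    obtain ⟨h, hh⟩ := Finset.card_pos.1 (by omega : 0 < H.card)
    exact (norm_nonneg h).trans (hbd h hh)
  set u := Real.logb 2 (n * w) with hu
  have hu1 : 1 ≤ u := by
    rw [hu, Real.le_logb_iff_rpow_le (by norm_num) (by linarith)]
    simpa using hnw
  set L := ⌈u⌉₊ with hLdef
  have hL0 : 0 < L := Nat.ceil_pos.2 (by linarith)
  have hLu : (L : ℝ) ≤ 2 * u := by linarith [Nat.ceil_lt_add_one (show 0 ≤ u by linarith)]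
  have hnwL : (n : ℝ) * w ≤ 2 ^ L := by
    have h1 := Nat.le_ceil u
    rw [hu, Real.logb_le_iff_le_rpow (by norm_num) (by linarith), Real.rpow_natCast] at h1
    exact h1
  obtain ⟨X, hXcard, hX⟩ := exists_comparison_representatives hH
  -- With m = 16nL and M = 16m = 256nL, this makes Aκ = 4M, the cost of one sorting round.
  set A : ℝ := 1024 * n * L / κ with hA
  obtain ⟨T, hT, hTX⟩ := solvable_of_potential hw
    (pow_lt_two_pow_of_le_two_pow hw hn hL0 hnwL) le_rfl
    (by positivity) hint hbd (A := A) (by positivity) (by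
      rw [hA, div_mul_cancel₀ _ hκ.ne']
      push_cast
      linarith) X
  have hl : 1 ≤ Real.logb 2 H.card := by
    rw [Real.le_logb_iff_rpow_le (by norm_num) (by positivity)]
    simpa using (Nat.cast_le (α := ℝ)).2 hH
  have hXlog : Real.logb 2 X.card ≤ 5 * n * Real.logb 2 H.card := by
    have := logb_natCast_le_of_le hXcard
    rw [Nat.cast_pow, Real.logb_pow] at this
    exact_mod_cast this
  have hRlog : Real.logb 2 (1 + (unresolved H X).card) ≤ 2 * Real.logb 2 H.card := by
    have h1 : 1 + (unresolved H X).card ≤ H.card ^ 2 := by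
      have : (unresolved H X).card ≤ H.card := Finset.card_filter_le _ _
      nlinarith
    have := logb_natCast_le_of_le h1
    rw [Nat.cast_pow, Real.logb_pow] at this
    exact_mod_cast this
  have hbound : A * Real.logb 2 (1 + (unresolved H X).card) + 10 * Real.logb 2 X.card ≤
      (4096 / κ + 50) / (Real.log 2 * Real.log 2) *
        (n * Real.log (n * w) * Real.log H.card) := by
    have hAu : A ≤ 2048 / κ * (n * u) := by
      calc A = 1024 / κ * n * L := by rw [hA]; ring
        _ ≤ 1024 / κ * n * (2 * u) := mul_le_mul_of_nonneg_left hLu (by positivity)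
        _ = _ := by ring
    have hnu : (n : ℝ) ≤ n * u := le_mul_of_one_le_right (by positivity) hu1
    calc _ ≤ 2048 / κ * (n * u) * (2 * Real.logb 2 H.card) +
            10 * (5 * n * Real.logb 2 H.card) := by
          refine add_le_add (mul_le_mul hAu hRlog (Real.logb_nonneg (by norm_num) (by simp)) ?_) ?_
          · positivity
          · linarith
      _ ≤ (4096 / κ + 50) * (n * u * Real.logb 2 H.card) := by
          have h1 := mul_le_mul_of_nonneg_right hnu (show 0 ≤ Real.logb 2 H.card by linarith)
          have h2 : 4096 / κ = 2 * (2048 / κ) := by ring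
          rw [h2]
          linarith
      _ = _ := by
          rw [hu, Real.logb, Real.logb]
          field_simp
  refine ⟨T, hT, fun y => ?_, fun y => ?_⟩ <;> obtain ⟨x, hx, hxy⟩ := hX y
  · rw [(LinearDecisionTree.IsComparison.eval_eq_and_numQueries_eq hxy T hT).1, (hTX x hx).1]
    funext h
    exact (hxy h (Or.inl h.2)).symm
  · rw [(LinearDecisionTree.IsComparison.eval_eq_and_numQueries_eq hxy T hT).2]
    exact (hTX x hx).2.trans hbound
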